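/- Let $\mathbb{L}$ be a Dedekind complete $f$-algebra over $\mathbb{R}$ with multiplicative unit $1$, and let $\mathbb{L}_1$ be the order ideal generated by $1$. For $\lambda\in\mathbb{L}^+$ and real $p\ge 0$ let $\lambda^p$ be the pointwise power in the representation of $\mathbb{L}$ as an order dense ideal of $C_\infty(K)$ ($K$ Stonean, $1\leftrightarrow\mathbf 1_K$); equivalently $\lambda^p=\sup\{r^p e: r\ge 0 \text{ real},\ e^2=e,\ re\le\lambda\}$. Let $(S,\Sigma)$ be a measurable space and let $\mu\colon\Sigma\to\mathbb{L}^+$ satisfy $\mu(\emptyset)=0$ and $\mu(\bigcup_n A_n)=\sup_{F\subseteq\mathbb{N}\text{ finite}}\sum_{n\in F}\mu(A_n)$ for every disjoint sequence $(A_n)$ in $\Sigma$. A measurable step function is a function $\varphi=\sum_{i=1}^m\lambda_i\mathbf 1_{A_i}$ with $\lambda_i\in\mathbb{L}$ and $A_1,\dots,A_m\in\Sigma$ a partition of $S$; its integral is $\int\varphi\,d\mu=\sum_i\lambda_i\mu(A_i)$, and it is bounded if its values lie in $\mathbb{L}_1$. Assume that $\mu$ is proper: whenever $(\varphi_n)$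 is a sequence of positive bounded measurable step functions with $\varphi_n(s)\downarrow 0$ for every $s\in S$, then $\int\varphi_n\,d\mu\downarrow 0$ in $\mathbb{L}$. A function $f\colon S\to\mathbb{L}^+$ is measurable if it is the pointwise supremum of an increasing sequence of positive measurable step functions, and $f\colon S\to\mathbb{L}$ is measurable if $f^+$ and $f^-$ are. For measurable $f\colon S\to\mathbb{L}^+$ put $\int f\,d\mu=\sup_n\int\varphi_n\,d\mu$, if this supremum exists in $\mathbb{L}$, where $(\varphi_n)$ is a sequence of positive bounded measurable step functions with $\varphi_n\uparrow f$ pointwise. Let $\mathcal{L}^1$ be the set of measurable $f\colon S\to\mathbb{L}$ for which $\int|f|\,d\mu$ exists in $\mathbb{L}$. A property holds $\mu$-almost everywhere if it holds outside a subset of some $N\in\Sigma$ with $\mu(N)=0$. For $1\le p<\infty$ let $\mathcal{L}^p$ be the set of measurable $f\colon S\to\mathbb{L}$ with $|f|^p\in\mathcal{L}^1$, and put $\|f\|_p=\left(\int|f|^p\,d\mu\right)^{1/p}$. Let $\mathcal{L}^\infty$ be the set of measurable $f\colon S\to\mathbb{L}$ such that $|f|\le\lambda$ $\mu$-almost everywhere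 for some $\lambda\in\mathbb{L}^+$, and put $\|f\|_\infty=\inf\{\lambda\in\mathbb{L}^+: |f|\le\lambda\ \mu\text{-almost everywhere}\}$. For $1\le p\le\infty$ let $\mathcal{N}_p=\{f\in\mathcal{L}^p:\|f\|_p=0\}$. **Theorem.** Let $1\le p<q\le\infty$. Then: 1. $\mathcal{L}^q\subseteq\mathcal{L}^p$, and for every $f\in\mathcal{L}^q$ $$\|f\|_p\le\|f\|_q\;\mu(S)^{\frac1p-\frac1q},$$ where $\frac1\infty=0$ (so the exponent is $\frac{q-p}{qp}$ if $q<\infty$ and $\frac1p$ if $q=\infty$). 2. $\mathcal{N}_\infty\subseteq\mathcal{N}_1=\mathcal{N}_p$. In particular the kernel of $\|\cdot\|_p$ does not depend on $p\in[1,\infty)$. -/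

import Mathlib

open scoped ENNReal
open MeasureTheory

/-- `𝕃` is an `f`-algebra over `ℝ` with a multiplicative unit: a vector lattice with an associative
multiplication for which products of positive elements are positive and multiplication by positive
elements preserves disjointness. Commutativity and `0 ≤ 1` are not assumed. Together with
`[ConditionallyCompleteLattice 𝕃]` this is a Dedekind complete unital `f`-algebra. -/
class IsFAlgebra (𝕃 : Type*) [Lattice 𝕃] [Ring 𝕃] [Algebra ℝ 𝕃] : Prop
    extends IsOrderedAddMonoid 𝕃 where
  smul_nonneg' : ∀ (c : ℝ) (x : 𝕃), 0 ≤ c → 0 ≤ x → 0 ≤ c • x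
  mul_nonneg' : ∀ x y : 𝕃, 0 ≤ x → 0 ≤ y → 0 ≤ x * y
  inf_mul_left : ∀ x y z : 𝕃, x ⊓ y = 0 → 0 ≤ z → (z * x) ⊓ y = 0
  inf_mul_right : ∀ x y z : 𝕃, x ⊓ y = 0 → 0 ≤ z → (x * z) ⊓ y = 0

namespace LValued

/-! ### Real powers of positive elements -/

section Powers

variable {𝕃 : Type*} [ConditionallyCompleteLattice 𝕃] [Ring 𝕃] [Algebra ℝ 𝕃]

/-- The elements `r ^ p • e`, where `r ≥ 0` is real, `e` is idempotent and `r • e ≤ x`. -/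
def powSet (x : 𝕃) (p : ℝ) : Set 𝕃 :=
  {y | ∃ (r : ℝ) (e : 𝕃), 0 ≤ r ∧ e * e = e ∧ r • e ≤ x ∧ y = (r ^ p) • e}

/-- The power `x ^ p` of `0 ≤ x` in `𝕃` for real `p ≥ 0`. When `𝕃` is represented as an order dense
ideal of `C_∞(K)`, `K` Stonean, with the unit of `𝕃` represented by the constant function one,
the idempotents are the indicator functions of the clopen subsets `U` of `K`, so that `x ^ p` is
the supremum of all `r ^ p · 1_U` with `r ≤ x` on `U`, which is the pointwise power of `x`. -/
noncomputable def lpow (x : 𝕃) (p : ℝ) : 𝕃 := sSup (powSet x p)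

theorem mul_self_nonneg_aux [IsFAlgebra 𝕃] (a : 𝕃) : 0 ≤ a * a := by
  have h0 : a⁺ ⊓ a⁻ = 0 := posPart_inf_negPart_eq_zero a
  have h0' : a⁻ ⊓ a⁺ = 0 := by rw [inf_comm]; exact h0
  have key : ∀ x y : 𝕃, 0 ≤ x → 0 ≤ y → x ⊓ y = 0 → x * y = 0 := by
    intro x y hx hy h
    have h1 : (x * y) ⊓ y = 0 := IsFAlgebra.inf_mul_right x y y h hy
    have h2 : y ⊓ (x * y) = 0 := by rw [inf_comm]; exact h1
    have h3 := IsFAlgebra.inf_mul_left y (x * y) x h2 hx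
    simpa using h3
  have e1 := key _ _ (posPart_nonneg a) (negPart_nonneg a) h0
  have e2 := key _ _ (negPart_nonneg a) (posPart_nonneg a) h0'
  have e3 : a * a = a⁺ * a⁺ + a⁻ * a⁻ := by
    calc a * a = (a⁺ - a⁻) * (a⁺ - a⁻) := by rw [posPart_sub_negPart]
      _ = a⁺ * a⁺ + a⁻ * a⁻ - a⁺ * a⁻ - a⁻ * a⁺ := by noncomm_ring
      _ = _ := by rw [e1, e2]; simp
  rw [e3]
  exact add_nonneg (IsFAlgebra.mul_nonneg' _ _ (posPart_nonneg a) (posPart_nonneg a))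
    (IsFAlgebra.mul_nonneg' _ _ (negPart_nonneg a) (negPart_nonneg a))

/-- For `0 ≤ x` and `0 ≤ p` the supremum defining `lpow x p` exists in `𝕃`. -/
theorem isLUB_lpow [IsFAlgebra 𝕃] {x : 𝕃} (hx : 0 ≤ x) {p : ℝ} (hp : 0 ≤ p) :
    IsLUB (powSet x p) (lpow x p) := by
  have hmul : ∀ a b c : 𝕃, 0 ≤ c → a ≤ b → a * c ≤ b * c := by
    intro a b c hc hab
    have h := IsFAlgebra.mul_nonneg' (b - a) c (sub_nonneg.2 hab) hc
    rwa [sub_mul, sub_nonneg] at h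
  have hmul' : ∀ a b c : 𝕃, 0 ≤ c → a ≤ b → c * a ≤ c * b := by
    intro a b c hc hab
    have h := IsFAlgebra.mul_nonneg' c (b - a) hc (sub_nonneg.2 hab)
    rwa [mul_sub, sub_nonneg] at h
  have h1 : (0 : 𝕃) ≤ 1 := by simpa using mul_self_nonneg_aux (1 : 𝕃)
  have hpow : ∀ n : ℕ, 0 ≤ x ^ n := by
    intro n
    induction n with
    | zero => simpa using h1
    | succ n ih => rw [pow_succ]; exact IsFAlgebra.mul_nonneg' _ _ ih hx
  refine isLUB_csSup ⟨0, 0, 0, le_rfl, by simp, by simpa using hx, by simp⟩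
    ⟨1 + x ^ (⌈p⌉₊), ?_⟩
  rintro y ⟨r, e, hr, he, hre, rfl⟩
  have he0 : 0 ≤ e := by rw [← he]; exact mul_self_nonneg_aux e
  have he1 : e ≤ 1 := by
    have h := mul_self_nonneg_aux (1 - e)
    have h' : (1 - e) * (1 - e) = 1 - e := by
      rw [sub_mul, mul_sub, mul_sub, he]; simp
    rw [h', sub_nonneg] at h
    exact h
  have hn : ∀ n : ℕ, (r ^ n) • e ≤ x ^ n * e := by
    intro n
    induction n with
    | zero => simp
    | succ n ih =>
      have hq : 0 ≤ (r ^ n) • e := IsFAlgebra.smul_nonneg' _ _ (pow_nonneg hr n) he0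
      calc (r ^ (n + 1)) • e = (r • e) * ((r ^ n) • e) := by
            rw [smul_mul_smul_comm, he, pow_succ, mul_comm]
        _ ≤ x * ((r ^ n) • e) := hmul _ _ _ hq hre
        _ ≤ x * (x ^ n * e) := hmul' _ _ _ hx ih
        _ = x ^ (n + 1) * e := by rw [← mul_assoc, ← pow_succ']
  have hle : r ^ p ≤ 1 + r ^ (⌈p⌉₊) := by
    rcases le_total r 1 with h | h
    · have := Real.rpow_le_one hr h hp
      have := pow_nonneg hr (⌈p⌉₊)
      linarith
    · have := Real.rpow_le_rpow_of_exponent_le h (Nat.le_ceil p)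
      rw [Real.rpow_natCast] at this
      linarith
  calc (r ^ p) • e ≤ (1 + r ^ (⌈p⌉₊)) • e := by
        have h := IsFAlgebra.smul_nonneg' _ _ (sub_nonneg.2 hle) he0
        rwa [sub_smul, sub_nonneg] at h
    _ = e + (r ^ (⌈p⌉₊)) • e := by rw [add_smul, one_smul]
    _ ≤ 1 + x ^ (⌈p⌉₊) := by
        refine add_le_add he1 ((hn _).trans ?_)
        simpa using hmul' _ _ _ (hpow (⌈p⌉₊)) he1

end Powers

/-! ### Monotone order limits -/

section Order

variable {𝕃 : Type*} [ConditionallyCompleteLattice 𝕃]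

/-- `u n ↑ a` -/
def IncreasesTo (u : ℕ → 𝕃) (a : 𝕃) : Prop := Monotone u ∧ IsLUB (Set.range u) a

/-- `u n ↓ a` -/
def DecreasesTo (u : ℕ → 𝕃) (a : 𝕃) : Prop := Antitone u ∧ IsGLB (Set.range u) a

end Order

/-! ### Measures with values in `𝕃` -/

/-- A finite `𝕃`-valued measure on the measurable space `S`. The values of `toFun` on non-measurable
sets are irrelevant and are never used. -/
structure LMeasure (S 𝕃 : Type*) [MeasurableSpace S] [ConditionallyCompleteLattice 𝕃]
    [Ring 𝕃] where
  toFun : Set S → 𝕃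
  nonneg' : ∀ A, MeasurableSet A → 0 ≤ toFun A
  empty' : toFun ∅ = 0
  iUnion' : ∀ A : ℕ → Set S, (∀ n, MeasurableSet (A n)) → Pairwise (Function.onFun Disjoint A) →
    IsLUB (Set.range fun F : Finset ℕ => ∑ n ∈ F, toFun (A n)) (toFun (⋃ n, A n))

section Integration

variable {S 𝕃 : Type*} [MeasurableSpace S] [ConditionallyCompleteLattice 𝕃] [Ring 𝕃]

/-- The integral `∑ λᵢ μ(Aᵢ)` of a measurable step function `∑ λᵢ 1_{Aᵢ}`. Measurable step functions
are Mathlib's simple functions: finitely many values, each taken on a measurable set. -/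
noncomputable def LMeasure.stepIntegral (μ : LMeasure S 𝕃) (φ : SimpleFunc S 𝕃) : 𝕃 :=
  ∑ x ∈ φ.range, x * μ.toFun (φ ⁻¹' {x})

/-- `P` holds `μ`-almost everywhere: the exceptional set is contained in a measurable null set. -/
def LMeasure.AE (μ : LMeasure S 𝕃) (P : S → Prop) : Prop :=
  ∃ N : Set S, MeasurableSet N ∧ μ.toFun N = 0 ∧ {s | ¬ P s} ⊆ N

/-- `f : S → 𝕃` is the pointwise limit of an increasing sequence of positive step functions;
this describes the positive measurable functions with values in `𝕃`. -/
def IsMeasurablePos (f : S → 𝕃) : Prop :=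
  ∃ φ : ℕ → SimpleFunc S 𝕃, (∀ n s, 0 ≤ φ n s) ∧ ∀ s, IncreasesTo (fun n => φ n s) (f s)

/-- A function `f : S → 𝕃` is measurable if its positive and negative parts are. -/
def IsLMeasurable (f : S → 𝕃) : Prop :=
  IsMeasurablePos (fun s => f s ⊔ 0) ∧ IsMeasurablePos (fun s => (-f s) ⊔ 0)

variable [Algebra ℝ 𝕃]

/-- `φ` is positive with values in `𝕃₁`, the order ideal of `𝕃` generated by the unit. -/
def IsBoundedPosStep (φ : SimpleFunc S 𝕃) : Prop :=
  ∀ s, 0 ≤ φ s ∧ ∃ c : ℝ, |φ s| ≤ c • (1 : 𝕃)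

/-- `μ` is proper: if positive bounded step functions decrease pointwise to `0`, then so do their
integrals. -/
def LMeasure.IsProper (μ : LMeasure S 𝕃) : Prop :=
  ∀ φ : ℕ → SimpleFunc S 𝕃, (∀ n, IsBoundedPosStep (φ n)) →
    (∀ s, DecreasesTo (fun n => φ n s) 0) → DecreasesTo (fun n => μ.stepIntegral (φ n)) 0

/-- `I ∈ 𝕃` is the integral of the positive function `f`: for some sequence of positive bounded step
functions increasing pointwise to `f`, the integrals have supremum `I` in `𝕃`. -/
def LMeasure.HasIntegral (μ : LMeasure S 𝕃) (f : S → 𝕃) (I : 𝕃) : Prop :=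
  ∃ φ : ℕ → SimpleFunc S 𝕃, (∀ n, IsBoundedPosStep (φ n)) ∧
    (∀ s, IncreasesTo (fun n => φ n s) (f s)) ∧
    IsLUB (Set.range fun n => μ.stepIntegral (φ n)) I

open Classical in
/-- The integral of a positive integrable function; only used when it exists in `𝕃`. -/
noncomputable def LMeasure.integral (μ : LMeasure S 𝕃) (f : S → 𝕃) : 𝕃 :=
  if h : ∃ I, μ.HasIntegral f I then h.choose else 0

/-- The space `ℒ¹`: measurable `f` for which the integral of `|f|` exists in `𝕃`. -/
def LMeasure.Integrable (μ : LMeasure S 𝕃) (f : S → 𝕃) : Prop :=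
  IsLMeasurable f ∧ ∃ I, μ.HasIntegral (fun s => |f s|) I

/-- `f` is essentially bounded. -/
def LMeasure.EssBounded (μ : LMeasure S 𝕃) (f : S → 𝕃) : Prop :=
  IsLMeasurable f ∧ ∃ l : 𝕃, 0 ≤ l ∧ μ.AE (fun s => |f s| ≤ l)

open Classical in
/-- The space `ℒᵖ(S, Σ, μ; 𝕃)` of functions `S → 𝕃`, for `1 ≤ p ≤ ∞`. -/
def LMeasure.Lp (μ : LMeasure S 𝕃) (p : ℝ≥0∞) : Set (S → 𝕃) :=
  if p = ∞ then {f | μ.EssBounded f}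
  else {f | IsLMeasurable f ∧ μ.Integrable (fun s => lpow |f s| p.toReal)}

open Classical in
/-- The `𝕃`-valued seminorm `‖f‖ₚ` of `f ∈ ℒᵖ`, for `1 ≤ p ≤ ∞`. -/
noncomputable def LMeasure.norm (μ : LMeasure S 𝕃) (p : ℝ≥0∞) (f : S → 𝕃) : 𝕃 :=
  if p = ∞ then sInf {l : 𝕃 | 0 ≤ l ∧ μ.AE (fun s => |f s| ≤ l)}
  else lpow (μ.integral (fun s => lpow |f s| p.toReal)) (1 / p.toReal)

/-- The null space `𝒩ₚ`, the kernel of `‖·‖ₚ` in `ℒᵖ`. -/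
def LMeasure.nullSpace (μ : LMeasure S 𝕃) (p : ℝ≥0∞) : Set (S → 𝕃) :=
  {f | f ∈ μ.Lp p ∧ μ.norm p f = 0}

end Integration

end LValued

set_option linter.unusedSectionVars false

namespace LValued

/-! ### Order structure of the algebra: Archimedean property, disjointness, suprema -/

section Algebra

variable {𝕃 : Type*} [ConditionallyCompleteLattice 𝕃] [Ring 𝕃] [Algebra ℝ 𝕃] [IsFAlgebra 𝕃]

/-! The proof never uses the representation in `C_∞(K)`: idempotents `e` play the role of clopen
sets. If `x ≤ y` fails, then on some nonzero `e` the element `x` exceeds `y` by a real `δ > 0`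
(`exists_idem_of_not_le`). Shrinking `e`, any given element becomes bounded on it, then constant up
to `ε`, so that a contradiction between real numbers remains. In this way real inequalities and
continuity of powers pass to `𝕃`.

Hölder's inequality against the constant one comes from Young's inequality with real parameters: `x
^ p ≤ (K(p/q)/a) x ^ q + K(1 - p/q)/b` with `K = a ^ (p/q) * b ^ (1 - p/q)`. Write `I` and `J` for
the integrals of `|f| ^ p` and `|f| ^ q`, and `M = μ(S)`. Integrating bounds `I` by the same
combination of `J` and `M`; on an idempotent where `J ≤ a` and `M ≤ b` it is at most `K`.
`lpow_le_mul` glues these local bounds into `I ^ (1/p) ≤ J ^ (1/q) * M ^ (1/p - 1/q)`. For `q = ∞`,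
every essential bound `l` gives `I ≤ l ^ p * M`; one takes roots and then the infimum over `l`
(`le_csInf_mul`).

Properness enters through `IsProper.stepIntegral_le`, which makes integrals monotone and independent
of the approximating sequence. Dedekind completeness turns an upper bound for the step integrals
into existence of the integral.

The norm inequality shows that null spaces decrease as the exponent grows. Conversely, if the
integral of `|f|` is `0`, truncations of `|f| ^ p` are dominated by real multiples of `|f|`, so
their integrals vanish. -/

instance instIsOrderedRing : IsOrderedRing 𝕃 where
  zero_le_one := by simpa using mul_self_nonneg_aux (1 : 𝕃)
  mul_le_mul_of_nonneg_left := by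
    intro c hc a b hab
    have h := IsFAlgebra.mul_nonneg' c (b - a) hc (sub_nonneg.2 hab)
    rwa [mul_sub, sub_nonneg] at h
  mul_le_mul_of_nonneg_right := by
    intro c hc a b hab
    have h := IsFAlgebra.mul_nonneg' (b - a) c (sub_nonneg.2 hab) hc
    rwa [sub_mul, sub_nonneg] at h

instance instIsOrderedModule : IsOrderedModule ℝ 𝕃 where
  smul_le_smul_of_nonneg_left := by
    intro c hc a b hab
    have h := IsFAlgebra.smul_nonneg' c (b - a) hc (sub_nonneg.2 hab)
    rwa [smul_sub, sub_nonneg] at h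
  smul_le_smul_of_nonneg_right := by
    intro c hc a b hab
    have h := IsFAlgebra.smul_nonneg' (b - a) c (sub_nonneg.2 hab) hc
    rwa [sub_smul, sub_nonneg] at h

/-- Multiplying one factor at a time preserves disjointness, so `x * y` becomes disjoint from
itself. -/
theorem mul_eq_zero_of_inf_eq_zero {x y : 𝕃} (hx : 0 ≤ x) (hy : 0 ≤ y) (h : x ⊓ y = 0) :
    x * y = 0 := by
  have h1 : (x * y) ⊓ y = 0 := IsFAlgebra.inf_mul_right x y y h hy
  have h2 : y ⊓ (x * y) = 0 := by rw [inf_comm]; exact h1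
  have h3 := IsFAlgebra.inf_mul_left y (x * y) x h2 hx
  simpa using h3

/-- Dedekind complete vector lattices are Archimedean. -/
theorem nonpos_of_forall_nsmul_le {x y : 𝕃} (h : ∀ n : ℕ, n • x ≤ y) : x ≤ 0 := by
  have hs : IsLUB (Set.range fun n : ℕ => n • x) (sSup (Set.range fun n : ℕ => n • x)) :=
    isLUB_csSup (Set.range_nonempty _) ⟨y, by rintro _ ⟨n, rfl⟩; exact h n⟩
  have : sSup (Set.range fun n : ℕ => n • x) ≤ sSup (Set.range fun n : ℕ => n • x) - x := by
    refine hs.2 ?_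
    rintro _ ⟨n, rfl⟩
    have := hs.1 ⟨n + 1, rfl⟩
    simp only [succ_nsmul] at this
    exact le_sub_iff_add_le.2 this
  simpa using this

theorem nonpos_of_forall_le_smul_one {x : 𝕃} (h : ∀ δ : ℝ, 0 < δ → x ≤ δ • (1 : 𝕃)) : x ≤ 0 := by
  refine nonpos_of_forall_nsmul_le (y := 1) fun n => ?_
  rcases n.eq_zero_or_pos with rfl | hn
  · simp [zero_le_one]
  · have hn' : (0 : ℝ) < n := by exact_mod_cast hn
    have := smul_le_smul_of_nonneg_left (h _ (inv_pos.2 hn')) hn'.le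
    rwa [smul_smul, mul_inv_cancel₀ hn'.ne', one_smul, Nat.cast_smul_eq_nsmul] at this

/-- Since `x ⊓ c ≤ y ⊓ c + (x - y)`, lowering `x` by `x ⊓ c - b` still leaves an upper bound of `s`.
This is the infinite distributive law of vector lattices. -/
theorem inf_le_of_isLUB {s : Set 𝕃} {x c b : 𝕃} (hs : IsLUB s x) (h : ∀ y ∈ s, y ⊓ c ≤ b) :
    x ⊓ c ≤ b := by
  have key : x ≤ x - (x ⊓ c - b) := by
    refine hs.2 fun y hy => ?_
    have h1 : x ⊓ c ≤ (y ⊓ c) + (x - y) := by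
      rw [inf_add]
      refine inf_le_inf (by simp) ?_
      simpa using hs.1 hy
    have h2 := h1.trans (add_le_add_left (h y hy) _)
    have e : x - (x ⊓ c - b) - y = b + (x - y) - x ⊓ c := by abel
    rw [← sub_nonneg, e, sub_nonneg]
    exact h2
  have : x ⊓ c - b ≤ 0 := by simpa using key
  exact sub_nonpos.1 this

/-! ### Idempotents -/

section Idempotents

variable {e e' : 𝕃}

theorem idem_nonneg (he : e * e = e) : 0 ≤ e := he ▸ mul_self_nonneg_aux e

theorem idem_compl (he : e * e = e) : (1 - e) * (1 - e) = 1 - e := by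
  rw [sub_mul, mul_sub, mul_sub, he]; simp

theorem idem_le_one (he : e * e = e) : e ≤ 1 :=
  sub_nonneg.1 (idem_nonneg (idem_compl he))

theorem idem_inf_compl (he : e * e = e) : e ⊓ (1 - e) = 0 := by
  have h0 : 0 ≤ e ⊓ (1 - e) := le_inf (idem_nonneg he) (idem_nonneg (idem_compl he))
  refine le_antisymm ?_ h0
  have h1 : e * (e ⊓ (1 - e)) ≤ e * (1 - e) := mul_le_mul_of_nonneg_left inf_le_right (idem_nonneg he)
  have h2 : (1 - e) * (e ⊓ (1 - e)) ≤ (1 - e) * e :=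
    mul_le_mul_of_nonneg_left inf_le_left (idem_nonneg (idem_compl he))
  have h3 := add_le_add h1 h2
  rw [← add_mul, mul_sub, sub_mul, he] at h3
  simpa using h3

/-- As `e` and `1 - e` are disjoint, `e * x * (1 - e)` and `(1 - e) * x * e` vanish for `x ≥ 0`, so
both sides equal `e * x * e`. This replaces commutativity of `𝕃`. -/
theorem idem_mul_comm (he : e * e = e) (x : 𝕃) : e * x = x * e := by
  have key : ∀ x : 𝕃, 0 ≤ x → e * x = x * e := by
    intro x hx
    have h0 := idem_nonneg he
    have h0' := idem_nonneg (idem_compl he)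
    have h1 : e * x * (1 - e) = 0 :=
      mul_eq_zero_of_inf_eq_zero (mul_nonneg h0 hx) h0'
        (IsFAlgebra.inf_mul_right _ _ _ (idem_inf_compl he) hx)
    have h2 : (1 - e) * x * e = 0 :=
      mul_eq_zero_of_inf_eq_zero (mul_nonneg h0' hx) h0
        (IsFAlgebra.inf_mul_right _ _ _ (by rw [inf_comm]; exact idem_inf_compl he) hx)
    rw [mul_sub, mul_one, sub_eq_zero] at h1
    rw [sub_mul, sub_mul, one_mul, sub_eq_zero] at h2
    rw [h1, h2]
  rw [← posPart_sub_negPart x, mul_sub, sub_mul, key _ (posPart_nonneg x),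
    key _ (negPart_nonneg x)]

theorem idem_mul_le (he : e * e = e) {x : 𝕃} (hx : 0 ≤ x) : e * x ≤ x := by
  simpa using mul_le_mul_of_nonneg_right (idem_le_one he) hx

theorem idem_mul_mul (he : e * e = e) (he' : e' * e' = e') : (e * e') * (e * e') = e * e' := by
  rw [mul_assoc, ← mul_assoc e', ← idem_mul_comm he e', mul_assoc e, he', ← mul_assoc, he]

theorem idem_mul_idem_mul (he : e * e = e) (x : 𝕃) : e * (e * x) = e * x := by
  rw [← mul_assoc, he]

theorem eq_zero_of_smul_idem_le (he : e * e = e) {a b : ℝ} (hab : b < a) (h : a • e ≤ b • e) :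
    e = 0 := by
  refine le_antisymm ?_ (idem_nonneg he)
  have h1 : (a - b) • e ≤ 0 := by rw [sub_smul]; exact sub_nonpos.2 h
  have h2 := smul_le_smul_of_nonneg_left h1 (inv_pos.2 (sub_pos.2 hab)).le
  rwa [smul_smul, inv_mul_cancel₀ (sub_pos.2 hab).ne', one_smul, smul_zero] at h2

theorem le_of_smul_idem_le (he : e * e = e) (h0 : e ≠ 0) {a b : ℝ} (h : a • e ≤ b • e) :
    a ≤ b := by
  by_contra hab
  exact h0 (eq_zero_of_smul_idem_le he (not_le.1 hab) h)

/-- The component of the unit in the band generated by `u`. -/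
theorem exists_idem_of_pos {u : 𝕃} (hu : 0 ≤ u) (hu0 : u ≠ 0) :
    ∃ e : 𝕃, e * e = e ∧ e ≠ 0 ∧ ∀ v : 𝕃, 0 ≤ v → u ⊓ v = 0 → e * v = 0 := by
  have h1 : (0 : 𝕃) ≤ 1 := zero_le_one
  have hlub : IsLUB (Set.range fun n : ℕ => (n • u) ⊓ 1) (sSup (Set.range fun n : ℕ => (n • u) ⊓ 1)) :=
    isLUB_csSup (Set.range_nonempty _) ⟨1, by rintro _ ⟨n, rfl⟩; exact inf_le_right⟩
  set e := sSup (Set.range fun n : ℕ => (n • u) ⊓ 1) with hedef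
  have he1 : e ≤ 1 := hlub.2 (by rintro _ ⟨n, rfl⟩; exact inf_le_right)
  have he0 : 0 ≤ e := by
    have := hlub.1 ⟨0, rfl⟩
    simpa [h1] using this
  have hdisj : e ⊓ (1 - e) = 0 := by
    refine le_antisymm ?_ (le_inf he0 (sub_nonneg.2 he1))
    refine inf_le_of_isLUB hlub ?_
    rintro _ ⟨n, rfl⟩
    have hn : 0 ≤ n • u := nsmul_nonneg hu n
    set w := (n • u) ⊓ 1 ⊓ (1 - e) with hw
    have hw1 : w ≤ n • u := inf_le_left.trans inf_le_left
    have hw2 : w ≤ 1 - e := inf_le_right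
    -- Adding `w` to a member `(m • u) ⊓ 1` stays below the member with index `m + n`, so `e - w` is
    -- again an upper bound and `w ≤ 0`.
    have key : e ≤ e - w := by
      refine hlub.2 ?_
      rintro _ ⟨m, rfl⟩
      have : (m • u) ⊓ 1 + w ≤ ((m + n) • u) ⊓ 1 := by
        refine le_inf ?_ ?_
        · rw [add_nsmul]; exact add_le_add inf_le_left hw1
        · calc (m • u) ⊓ 1 + w ≤ e + (1 - e) := add_le_add (hlub.1 ⟨m, rfl⟩) hw2
            _ = 1 := by abel
      exact le_sub_iff_add_le.2 (this.trans (hlub.1 ⟨m + n, rfl⟩))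
    simpa using key
  have hee : e * (1 - e) = 0 := mul_eq_zero_of_inf_eq_zero he0 (sub_nonneg.2 he1) hdisj
  refine ⟨e, ?_, ?_, ?_⟩
  · rw [mul_sub, mul_one, sub_eq_zero] at hee; exact hee.symm
  · intro h
    have h2 : u ⊓ 1 = 0 := by
      refine le_antisymm ?_ (le_inf hu h1)
      have := hlub.1 ⟨1, rfl⟩
      rw [h] at this
      simpa using this
    have := mul_eq_zero_of_inf_eq_zero hu h1 h2
    exact hu0 (by simpa using this)
  · intro v hv huv
    refine mul_eq_zero_of_inf_eq_zero he0 hv (le_antisymm ?_ (le_inf he0 hv))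
    refine inf_le_of_isLUB hlub ?_
    rintro _ ⟨n, rfl⟩
    have h3 : (u * (n : 𝕃)) ⊓ v = 0 := IsFAlgebra.inf_mul_right u v _ huv (Nat.cast_nonneg n)
    rw [← nsmul_eq_mul'] at h3
    rw [← h3]
    exact inf_le_inf_right _ inf_le_left

/-- By the Archimedean property `w = x - y - δ` has nonzero positive part for some `δ > 0`. The
component of the unit in the band of `w⁺` kills `w⁻`, so `w` is nonnegative there. -/
theorem exists_idem_of_not_le {x y : 𝕃} (h : ¬ x ≤ y) :
    ∃ δ : ℝ, 0 < δ ∧ ∃ e : 𝕃, e * e = e ∧ e ≠ 0 ∧ e * y + δ • e ≤ e * x := by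
  obtain ⟨δ, hδ, hd⟩ : ∃ δ : ℝ, 0 < δ ∧ ¬ x - y ≤ δ • (1 : 𝕃) := by
    by_contra! hc
    exact h (sub_nonpos.1 (nonpos_of_forall_le_smul_one hc))
  set w := x - y - δ • (1 : 𝕃) with hw
  have hw0 : w⁺ ≠ 0 := by
    rw [Ne, posPart_eq_zero]
    exact fun h' => hd (sub_nonpos.1 h')
  obtain ⟨e, he, he0, hev⟩ := exists_idem_of_pos (posPart_nonneg w) hw0
  refine ⟨δ, hδ, e, he, he0, ?_⟩
  have h1 : e * w = e * w⁺ := by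
    conv_lhs => rw [← posPart_sub_negPart w]
    rw [mul_sub, hev _ (negPart_nonneg w) (posPart_inf_negPart_eq_zero w), sub_zero]
  have h2 : 0 ≤ e * w := h1 ▸ mul_nonneg (idem_nonneg he) (posPart_nonneg w)
  rw [hw, mul_sub, mul_sub, mul_smul_comm, mul_one] at h2
  rw [← sub_nonneg]
  convert h2 using 1
  abel

/-- The gap between `e * x` and `e * y` vanishes off `e`; multiplying by `1 - e` therefore forces
`e' * (1 - e) = 0`. -/
theorem exists_subidem_of_not_le {x y : 𝕃} (he : e * e = e) (h : ¬ e * x ≤ e * y) :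
    ∃ δ : ℝ, 0 < δ ∧ ∃ e' : 𝕃, e' * e' = e' ∧ e' ≠ 0 ∧ e' * e = e' ∧
      e' * y + δ • e' ≤ e' * x := by
  obtain ⟨δ, hδ, e', he', he0, hle⟩ := exists_idem_of_not_le h
  have hsub : e' * e = e' := by
    have h1 := mul_le_mul_of_nonneg_right hle (idem_nonneg (idem_compl he))
    have hz : ∀ z : 𝕃, e' * (e * z) * (1 - e) = 0 := by
      intro z
      rw [idem_mul_comm he z, mul_assoc, mul_assoc, mul_sub, he]
      simp
    rw [add_mul, hz, hz, zero_add, smul_mul_assoc] at h1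
    have hi : (e' * (1 - e)) * (e' * (1 - e)) = e' * (1 - e) := idem_mul_mul he' (idem_compl he)
    have := eq_zero_of_smul_idem_le hi hδ (by simpa using h1)
    rw [mul_sub, mul_one, sub_eq_zero] at this
    exact this.symm
  refine ⟨δ, hδ, e', he', he0, hsub, ?_⟩
  rwa [← mul_assoc, ← mul_assoc, hsub] at hle

theorem subidem_mul_le {x y : 𝕃} (he' : e' * e' = e') (hsub : e' * e = e') (h : e * x ≤ e * y) :
    e' * x ≤ e' * y := by
  have := mul_le_mul_of_nonneg_left h (idem_nonneg he')
  rwa [← mul_assoc, ← mul_assoc, hsub] at this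

theorem subidem_mul_le_smul {x : 𝕃} {a : ℝ} (he' : e' * e' = e') (hsub : e' * e = e')
    (h : e * x ≤ a • e) : e' * x ≤ a • e' := by
  have := subidem_mul_le (y := a • (1 : 𝕃)) he' hsub (by simpa using h)
  simpa using this

theorem subidem_smul_le_mul {x : 𝕃} {a : ℝ} (he' : e' * e' = e') (hsub : e' * e = e')
    (h : a • e ≤ e * x) : a • e' ≤ e' * x := by
  have := subidem_mul_le (x := a • (1 : 𝕃)) he' hsub (by simpa using h)
  simpa using this

theorem subidem_trans {e'' : 𝕃} (h1 : e'' * e' = e'') (h2 : e' * e = e') : e'' * e = e'' := by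
  rw [← h1, mul_assoc, h2]

/-- If `N • e ≤ e * x` held for every `N`, then `e = 0`. Where it fails for some `N`, the constant
`N` dominates `x`. -/
theorem exists_subidem_bound (x : 𝕃) (he : e * e = e) (he0 : e ≠ 0) :
    ∃ N : ℕ, ∃ e' : 𝕃, e' * e' = e' ∧ e' ≠ 0 ∧ e' * e = e' ∧ e' * x ≤ (N : ℝ) • e' := by
  obtain ⟨N, hN⟩ : ∃ N : ℕ, ¬ N • e ≤ e * x := by
    by_contra! hc
    exact he0 (le_antisymm (nonpos_of_forall_nsmul_le hc) (idem_nonneg he))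
  obtain ⟨δ, hδ, e', he', he0', hsub, hle⟩ :=
    exists_subidem_of_not_le (x := (N : ℝ) • (1 : 𝕃)) (y := x) he
      (by rwa [mul_smul_comm, mul_one, Nat.cast_smul_eq_nsmul])
  refine ⟨N, e', he', he0', hsub, ?_⟩
  rw [mul_smul_comm, mul_one] at hle
  exact le_trans (le_add_of_nonneg_right (smul_nonneg hδ.le (idem_nonneg he'))) hle

/-- The values of `x` are discretised on the grid `k * ε`. The bound `N` stops the grid, so some
level `k` is reached on a nonzero part of `e` while level `k + 1` is reached on none. -/
theorem exists_subidem_approx {x : 𝕃} (hx : 0 ≤ x) (he : e * e = e) (he0 : e ≠ 0) {N ε : ℝ}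
    (hN : e * x ≤ N • e) (hε : 0 < ε) :
    ∃ a : ℝ, 0 ≤ a ∧ a ≤ N ∧ ∃ e' : 𝕃, e' * e' = e' ∧ e' ≠ 0 ∧ e' * e = e' ∧
      a • e' ≤ e' * x ∧ e' * x ≤ (a + ε) • e' := by
  classical
  let P : ℕ → Prop := fun k => ∃ e' : 𝕃, e' * e' = e' ∧ e' ≠ 0 ∧ e' * e = e' ∧
    (k * ε) • e' ≤ e' * x
  have hPN : ∀ k, P k → k * ε ≤ N := by
    rintro k ⟨e', he', he0', hsub, h⟩
    exact le_of_smul_idem_le he' he0' (h.trans (subidem_mul_le_smul he' hsub hN))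
  have hP0 : P 0 := ⟨e, he, he0, he, by simpa using mul_nonneg (idem_nonneg he) hx⟩
  have hex : ∃ k, ¬ P k := by
    obtain ⟨k, hk⟩ := exists_nat_gt (N / ε)
    exact ⟨k, fun h => absurd (hPN k h) (not_le.2 ((div_lt_iff₀ hε).1 hk))⟩
  obtain ⟨k, hk, hk'⟩ : ∃ k, P k ∧ ¬ P (k + 1) := by
    by_contra! hc
    obtain ⟨k, hk⟩ := hex
    exact hk (Nat.rec hP0 hc k)
  obtain ⟨e', he', he0', hsub, h⟩ := hk
  refine ⟨k * ε, by positivity, hPN k ⟨e', he', he0', hsub, h⟩, e', he', he0', hsub, h, ?_⟩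
  by_contra hc
  obtain ⟨δ, hδ, e'', he'', he0'', hsub', hle⟩ :=
    exists_subidem_of_not_le (x := x) (y := (k * ε + ε) • (1 : 𝕃)) he' (by simpa using hc)
  refine hk' ⟨e'', he'', he0'', subidem_trans hsub' hsub, ?_⟩
  refine le_trans ?_ hle
  rw [mul_smul_comm, mul_one]
  have : ((k + 1 : ℕ) * ε : ℝ) = k * ε + ε := by push_cast; ring
  rw [this]
  exact le_add_of_nonneg_right (smul_nonneg hδ.le (idem_nonneg he''))

end Idempotents

/-! ### Powers -/

section LPow

variable {x y z : 𝕃} {p : ℝ}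

theorem smul_idem_le_lpow (hx : 0 ≤ x) (hp : 0 ≤ p) {r : ℝ} {e : 𝕃} (hr : 0 ≤ r) (he : e * e = e)
    (h : r • e ≤ x) : r ^ p • e ≤ lpow x p :=
  (isLUB_lpow hx hp).1 ⟨r, e, hr, he, h, rfl⟩

theorem lpow_le (hx : 0 ≤ x) (hp : 0 ≤ p)
    (h : ∀ (r : ℝ) (e : 𝕃), 0 ≤ r → e * e = e → r • e ≤ x → r ^ p • e ≤ y) : lpow x p ≤ y :=
  (isLUB_lpow hx hp).2 (by rintro _ ⟨r, e, hr, he, hre, rfl⟩; exact h r e hr he hre)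

theorem lpow_nonneg (hx : 0 ≤ x) (hp : 0 ≤ p) : 0 ≤ lpow x p := by
  simpa using smul_idem_le_lpow hx hp (r := 0) (e := 0) le_rfl (by simp) (by simpa using hx)

theorem lpow_mono (hx : 0 ≤ x) (hxy : x ≤ y) (hp : 0 ≤ p) : lpow x p ≤ lpow y p :=
  lpow_le hx hp fun _ _ hr he h => smul_idem_le_lpow (hx.trans hxy) hp hr he (h.trans hxy)

theorem lpow_zero_of_pos (hp : 0 < p) : lpow (0 : 𝕃) p = 0 := by
  refine le_antisymm (lpow_le le_rfl hp.le fun r e hr he h => ?_) (lpow_nonneg le_rfl hp.le)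
  rcases hr.eq_or_lt with rfl | hr
  · simp [Real.zero_rpow hp.ne']
  · rw [eq_zero_of_smul_idem_le he hr (by simpa using h)]; simp

theorem eq_zero_of_lpow_eq_zero (hx : 0 ≤ x) (hp : 0 ≤ p) (h : lpow x p = 0) : x = 0 := by
  by_contra hne
  obtain ⟨δ, hδ, e, he, he0, hle⟩ := exists_idem_of_not_le
    (x := x) (y := 0) fun h' => hne (le_antisymm h' hx)
  rw [mul_zero, zero_add] at hle
  have h1 := smul_idem_le_lpow hx hp hδ.le he (hle.trans (idem_mul_le he hx))
  rw [h] at h1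
  exact he0 (eq_zero_of_smul_idem_le he (Real.rpow_pos_of_pos hδ p) (by simpa using h1))

/-- On an idempotent `e` where `x ≤ a` one has `x ^ p ≤ a ^ p`. -/
theorem idem_mul_lpow_le (hx : 0 ≤ x) (hp : 0 ≤ p) {e : 𝕃} (he : e * e = e) {a : ℝ} (ha : 0 ≤ a)
    (h : e * x ≤ a • e) : e * lpow x p ≤ a ^ p • e := by
  have he1 := idem_compl he
  have key : lpow x p ≤ a ^ p • e + (1 - e) * lpow x p := by
    refine lpow_le hx hp fun r e₁ hr he₁ hre => ?_
    have hs : r ^ p • e₁ = e * (r ^ p • e₁) + (1 - e) * (r ^ p • e₁) := by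
      rw [← add_mul]; simp
    rw [hs]
    refine add_le_add ?_ (mul_le_mul_of_nonneg_left (smul_idem_le_lpow hx hp hr he₁ hre)
      (idem_nonneg he1))
    have hi := idem_mul_mul he he₁
    rw [mul_smul_comm]
    have hle : r • (e * e₁) ≤ a • (e * e₁) := by
      have h2 := mul_le_mul_of_nonneg_left hre (idem_nonneg he)
      have h3 := mul_le_mul_of_nonneg_right (h2.trans h) (idem_nonneg he₁)
      rwa [mul_smul_comm, smul_mul_assoc, smul_mul_assoc, mul_assoc, he₁] at h3
    have hee : e * e₁ ≤ e := by
      simpa using mul_le_mul_of_nonneg_left (idem_le_one he₁) (idem_nonneg he)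
    by_cases hz : e * e₁ = 0
    · rw [hz, smul_zero]; exact smul_nonneg (Real.rpow_nonneg ha p) (idem_nonneg he)
    · have hra := le_of_smul_idem_le hi hz hle
      exact smul_le_smul (Real.rpow_le_rpow hr hra hp) hee (Real.rpow_nonneg hr p)
        (idem_nonneg he)
  rw [sub_mul, one_mul] at key
  have h4 : lpow x p - (lpow x p - e * lpow x p) ≤ a ^ p • e := sub_le_iff_le_add.2 key
  rwa [sub_sub_cancel] at h4

/-- If an upper bound `y` of the powers missed `r ^ p` somewhere below `x ≥ r`, then `y ≤ c ^ p`
with `c < r` on a nonzero idempotent. All `u n`, hence `x`, would be at most `c` there. -/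
theorem increasesTo_lpow {u : ℕ → 𝕃} (hu : ∀ n, 0 ≤ u n) (h : IncreasesTo u x)
    (hp : 0 < p) : IncreasesTo (fun n => lpow (u n) p) (lpow x p) := by
  have hux : ∀ n, u n ≤ x := fun n => h.2.1 ⟨n, rfl⟩
  have hx : 0 ≤ x := (hu 0).trans (hux 0)
  refine ⟨fun m n hmn => lpow_mono (hu m) (h.1 hmn) hp.le, ?_, ?_⟩
  · rintro _ ⟨n, rfl⟩; exact lpow_mono (hu n) (hux n) hp.le
  intro y hy
  have hy' : ∀ n, lpow (u n) p ≤ y := fun n => hy ⟨n, rfl⟩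
  have hy0 : 0 ≤ y := (lpow_nonneg (hu 0) hp.le).trans (hy' 0)
  refine lpow_le hx hp.le fun r e hr he hre => ?_
  by_contra hc
  obtain ⟨δ, hδ, e₁, he₁, he0, hsub, hle⟩ :=
    exists_subidem_of_not_le (x := r ^ p • (1 : 𝕃)) (y := y) he (by
      rw [mul_smul_comm, mul_one]
      exact fun h' => hc (h'.trans (idem_mul_le he hy0)))
  rw [mul_smul_comm, mul_one] at hle
  have hle' : e₁ * y ≤ (r ^ p - δ) • e₁ := by rw [sub_smul]; exact le_sub_iff_add_le.2 hle
  have hpos : 0 ≤ r ^ p - δ := by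
    refine le_of_smul_idem_le he₁ he0 (le_trans ?_ hle')
    rw [zero_smul]; exact mul_nonneg (idem_nonneg he₁) hy0
  set c := (r ^ p - δ) ^ (1 / p) with hcdef
  have hc0 : 0 ≤ c := Real.rpow_nonneg hpos _
  have hcp : c ^ p = r ^ p - δ := by
    rw [hcdef, ← Real.rpow_mul hpos, one_div, inv_mul_cancel₀ hp.ne', Real.rpow_one]
  have hcr : c < r := by
    by_contra hrc
    have := Real.rpow_le_rpow hr (not_lt.1 hrc) hp.le
    linarith
  have hun : ∀ n, e₁ * u n ≤ c • e₁ := by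
    intro n
    by_contra hn
    obtain ⟨δ', hδ', e₂, he₂, he0', hsub', hle₂⟩ :=
      exists_subidem_of_not_le (x := u n) (y := c • (1 : 𝕃)) he₁ (by simpa using hn)
    rw [mul_smul_comm, mul_one, ← add_smul] at hle₂
    have h1 := smul_idem_le_lpow (hu n) hp.le (add_nonneg hc0 hδ'.le) he₂
      (hle₂.trans (idem_mul_le he₂ (hu n)))
    have h2 := mul_le_mul_of_nonneg_left (h1.trans (hy' n)) (idem_nonneg he₂)
    rw [mul_smul_comm, he₂] at h2
    have h3 := le_of_smul_idem_le he₂ he0' (h2.trans (subidem_mul_le_smul he₂ hsub' hle'))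
    rw [← hcp] at h3
    have := Real.rpow_lt_rpow hc0 (lt_add_of_pos_right c hδ') hp
    linarith
  -- The local bound passes to the supremum through a global upper bound that leaves `x` unchanged
  -- off `e₁`.
  have hxe : x ≤ c • e₁ + (1 - e₁) * x := by
    refine h.2.2 ?_
    rintro _ ⟨n, rfl⟩
    have hs : u n = e₁ * u n + (1 - e₁) * u n := by rw [← add_mul]; simp
    rw [hs]
    exact add_le_add (hun n) (mul_le_mul_of_nonneg_left (hux n) (idem_nonneg (idem_compl he₁)))
  have hxe' : e₁ * x ≤ c • e₁ := by
    rw [sub_mul, one_mul] at hxe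
    have := sub_le_iff_le_add.2 hxe
    rwa [sub_sub_cancel] at this
  have h5 : r • e₁ ≤ e₁ * x := by
    have := mul_le_mul_of_nonneg_left hre (idem_nonneg he₁)
    rwa [mul_smul_comm, hsub] at this
  exact absurd (le_of_smul_idem_le he₁ he0 (h5.trans hxe')) (not_le.2 hcr)

/-- Truncation loses nothing in the limit: where `u n ≤ N`, it lies below the truncated term with
index `max n N`. -/
theorem increasesTo_inf_natCast {u : ℕ → 𝕃} (hu : ∀ n, 0 ≤ u n) (h : IncreasesTo u x) :
    IncreasesTo (fun n => u n ⊓ (n : ℝ) • (1 : 𝕃)) x := by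
  have hmono : Monotone fun n : ℕ => u n ⊓ (n : ℝ) • (1 : 𝕃) := fun m n hmn =>
    inf_le_inf (h.1 hmn) (smul_le_smul_of_nonneg_right (by exact_mod_cast hmn) zero_le_one)
  refine ⟨hmono, ?_, ?_⟩
  · rintro _ ⟨n, rfl⟩; exact inf_le_left.trans (h.2.1 ⟨n, rfl⟩)
  intro b hb
  refine h.2.2 ?_
  rintro _ ⟨n, rfl⟩
  by_contra hc
  obtain ⟨δ, hδ, e, he, he0, hle⟩ := exists_idem_of_not_le hc
  obtain ⟨N, e', he', he0', hsub, hN⟩ := exists_subidem_bound (u n) he he0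
  have h1 : e' * u n ≤ b := by
    refine le_trans (le_inf ?_ ?_) (hb ⟨max n N, rfl⟩)
    · exact (idem_mul_le he' (hu n)).trans (h.1 (le_max_left _ _))
    · refine hN.trans (smul_le_smul (by exact_mod_cast le_max_right _ _) (idem_le_one he')
        (Nat.cast_nonneg _) zero_le_one)
  have h2 := mul_le_mul_of_nonneg_left h1 (idem_nonneg he')
  rw [idem_mul_idem_mul he'] at h2
  have h3 : e' * (b + δ • (1 : 𝕃)) ≤ e' * u n :=
    subidem_mul_le he' hsub (by rw [mul_add, mul_smul_comm, mul_one]; exact hle)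
  rw [mul_add, mul_smul_comm, mul_one] at h3
  have h4 : δ • e' ≤ 0 := by simpa using h3.trans h2
  exact he0' (eq_zero_of_smul_idem_le he' hδ (by simpa using h4))

/-- Local upper bounds for `z` by products of powers give a global upper bound for a root. -/
theorem lpow_le_mul {X Y : 𝕃} {u s k : ℝ} (hx : 0 ≤ x) (hy : 0 ≤ y) (hz : 0 ≤ z)
    (hX0 : 0 ≤ X) (hY0 : 0 ≤ Y) (hu : 0 ≤ u) (hs : 0 ≤ s) (hk : 0 < k)
    (hX : ∀ (a : ℝ) (e : 𝕃), 0 ≤ a → e * e = e → a • e ≤ x → a ^ u • e ≤ X)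
    (hY : ∀ (a : ℝ) (e : 𝕃), 0 ≤ a → e * e = e → a • e ≤ y → a ^ s • e ≤ Y)
    (h : ∀ (a b : ℝ) (e : 𝕃), 0 < a → 0 < b → e * e = e → e * x ≤ a • e → e * y ≤ b • e →
      e * z ≤ ((a ^ u * b ^ s) ^ k) • e) :
    lpow z (1 / k) ≤ X * Y := by
  have hk' : 0 ≤ 1 / k := by positivity
  have hXY := mul_nonneg hX0 hY0
  refine lpow_le hz hk' fun r e hr he hre => ?_
  by_contra hc
  obtain ⟨δ, hδ, e₁, he₁, he0₁, hsub₁, hle⟩ :=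
    exists_subidem_of_not_le (x := r ^ (1 / k) • (1 : 𝕃)) (y := X * Y) he (by
      rw [mul_smul_comm, mul_one]
      exact fun h' => hc (h'.trans (idem_mul_le he hXY)))
  obtain ⟨N₁, e₂, he₂, he0₂, hsub₂, hN₁⟩ := exists_subidem_bound x he₁ he0₁
  obtain ⟨N₂, e₃, he₃, he0₃, hsub₃, hN₂⟩ := exists_subidem_bound y he₂ he0₂
  -- On this box a small enough `ε` changes the product by less than the gap `δ`. The sides have
  -- length `N + 1` because the upper approximations `a + ε`, `b + ε` with `ε ≤ 1` must stay inside.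
  have hcont : UniformContinuousOn (fun t : ℝ × ℝ => t.1 ^ u * t.2 ^ s)
      (Set.Icc 0 (N₁ + 1 : ℝ) ×ˢ Set.Icc 0 (N₂ + 1 : ℝ)) := by
    refine (isCompact_Icc.prod isCompact_Icc).uniformContinuousOn_of_continuous
      (Continuous.continuousOn ?_)
    exact (continuous_fst.rpow_const fun _ => Or.inr hu).mul
      (continuous_snd.rpow_const fun _ => Or.inr hs)
  obtain ⟨η, hη, hcont⟩ := Metric.uniformContinuousOn_iff.1 hcont δ hδ
  set ε := min 1 (η / 2) with hε
  have hε0 : 0 < ε := lt_min one_pos (half_pos hη)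
  have hε1 : ε ≤ 1 := min_le_left _ _
  have hεη : ε < η := (min_le_right _ _).trans_lt (half_lt_self hη)
  obtain ⟨a, ha, haN, e₄, he₄, he0₄, hsub₄, hxl, hxu⟩ :=
    exists_subidem_approx hx he₃ he0₃ (subidem_mul_le_smul he₃ hsub₃ hN₁) hε0
  obtain ⟨b, hb, hbN, e₅, he₅, he0₅, hsub₅, hyl, hyu⟩ :=
    exists_subidem_approx hy he₄ he0₄ (subidem_mul_le_smul he₄ hsub₄ hN₂) hε0
  have hxl' := subidem_smul_le_mul he₅ hsub₅ hxl
  have hxu' := subidem_mul_le_smul he₅ hsub₅ hxu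
  have hsub51 : e₅ * e₁ = e₅ :=
    subidem_trans hsub₅ (subidem_trans hsub₄ (subidem_trans hsub₃ hsub₂))
  have hg := hcont (a + ε, b + ε) ⟨⟨by positivity, by linarith⟩, ⟨by positivity, by linarith⟩⟩
    (a, b) ⟨⟨ha, by linarith⟩, ⟨hb, by linarith⟩⟩ (by
      rw [Prod.dist_eq]
      simp [abs_of_pos hε0, hεη])
  rw [Real.dist_eq] at hg
  have hg' := (abs_lt.1 hg).2
  dsimp only at hg'
  have hA : 0 ≤ (a + ε) ^ u * (b + ε) ^ s := by positivity
  -- The upper approximations bound `r ^ (1 / k)`, the lower ones bound `X * Y` from below. Their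
  -- products differ by less than `δ`, contradicting the gap.
  have h1 := h (a + ε) (b + ε) e₅ (by positivity) (by positivity) he₅ hxu' hyu
  have h2 : r • e₅ ≤ e₅ * z := by
    have := mul_le_mul_of_nonneg_left hre (idem_nonneg he₅)
    rwa [mul_smul_comm, subidem_trans hsub51 hsub₁] at this
  have h3 := le_of_smul_idem_le he₅ he0₅ (h2.trans h1)
  have h4 : r ^ (1 / k) ≤ (a + ε) ^ u * (b + ε) ^ s := by
    have := Real.rpow_le_rpow hr h3 hk'
    rwa [← Real.rpow_mul hA, mul_one_div_cancel hk.ne', Real.rpow_one] at this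
  have h5 := hX a e₅ ha he₅ (hxl'.trans (idem_mul_le he₅ hx))
  have h6 := hY b e₅ hb he₅ (hyl.trans (idem_mul_le he₅ hy))
  have h7 : (a ^ u * b ^ s) • e₅ ≤ X * Y := by
    have := mul_le_mul h5 h6 (smul_nonneg (by positivity) (idem_nonneg he₅)) hX0
    rwa [smul_mul_smul_comm, he₅] at this
  have h8 := mul_le_mul_of_nonneg_left h7 (idem_nonneg he₅)
  rw [mul_smul_comm, he₅] at h8
  have h9 : e₅ * (X * Y + δ • (1 : 𝕃)) ≤ e₅ * (r ^ (1 / k) • (1 : 𝕃)) :=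
    subidem_mul_le he₅ hsub51 (by rwa [mul_add, mul_smul_comm δ, mul_one])
  rw [mul_add, mul_smul_comm, mul_smul_comm, mul_one] at h9
  have h10 : (a ^ u * b ^ s + δ) • e₅ ≤ r ^ (1 / k) • e₅ := by
    rw [add_smul]; exact le_trans (add_le_add_left h8 _) h9
  have := le_of_smul_idem_le he₅ he0₅ h10
  linarith

/-- A gap `δ` on an idempotent where `y ≤ N` would keep every `l ∈ T` at least `δ / (N + 1)` above
`sInf T` there. The denominator `N + 1` avoids division by zero. -/
theorem le_csInf_mul {T : Set 𝕃} (hT : T.Nonempty) (hb : BddBelow T)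
    (h : ∀ l ∈ T, z ≤ l * y) : z ≤ sInf T * y := by
  have hglb := isGLB_csInf hT hb
  by_contra hc
  obtain ⟨δ, hδ, e, he, he0, hle⟩ := exists_idem_of_not_le hc
  obtain ⟨N, e', he', he0', hsub, hN⟩ := exists_subidem_bound y he he0
  have hN1 : (0 : ℝ) < N + 1 := by positivity
  have hle' : e' * (sInf T * y + δ • (1 : 𝕃)) ≤ e' * z :=
    subidem_mul_le he' hsub (by rwa [mul_add, mul_smul_comm, mul_one])
  rw [mul_add, mul_smul_comm, mul_one] at hle'
  have key : sInf T + (δ / (N + 1)) • e' ≤ sInf T := by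
    refine hglb.2 fun l hl => ?_
    have hd : 0 ≤ l - sInf T := sub_nonneg.2 (hglb.1 hl)
    have h1 : e' * (sInf T * y) + δ • e' ≤ e' * (l * y) :=
      hle'.trans (mul_le_mul_of_nonneg_left (h l hl) (idem_nonneg he'))
    have h2 : δ • e' ≤ (l - sInf T) * (e' * y) := by
      rw [← mul_assoc, ← idem_mul_comm he', mul_assoc, sub_mul, mul_sub]
      exact le_sub_iff_add_le'.2 h1
    have h3 : (l - sInf T) * (e' * y) ≤ (N + 1 : ℝ) • (l - sInf T) := by
      calc (l - sInf T) * (e' * y) ≤ (l - sInf T) * ((N : ℝ) • e') :=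
            mul_le_mul_of_nonneg_left hN hd
        _ = (N : ℝ) • (e' * (l - sInf T)) := by rw [mul_smul_comm, idem_mul_comm he']
        _ ≤ (N + 1 : ℝ) • (l - sInf T) :=
            smul_le_smul (by linarith) (idem_mul_le he' hd)
              (Nat.cast_nonneg _) hd
    have h4 := smul_le_smul_of_nonneg_left (h2.trans h3) (inv_pos.2 hN1).le
    rw [smul_smul, smul_smul, inv_mul_cancel₀ hN1.ne', one_smul, inv_mul_eq_div] at h4
    exact le_sub_iff_add_le'.1 h4
  have h5 : (δ / (N + 1)) • e' ≤ 0 := by simpa using key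
  exact he0' (eq_zero_of_smul_idem_le he' (div_pos hδ hN1) (by simpa using h5))

/-- Young's inequality. -/
theorem lpow_le_smul_lpow_add {p q a b : ℝ} (hx : 0 ≤ x) (hp : 0 < p) (hpq : p ≤ q) (ha : 0 < a)
    (hb : 0 < b) :
    lpow x p ≤ (a ^ (p / q) * b ^ (1 - p / q) * (p / q) / a) • lpow x q +
      (a ^ (p / q) * b ^ (1 - p / q) * (1 - p / q) / b) • (1 : 𝕃) := by
  have hq : 0 < q := hp.trans_le hpq
  have hw1 : 0 ≤ p / q := by positivity
  have hw2 : 0 ≤ 1 - p / q := by rw [sub_nonneg, div_le_one hq]; exact hpq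
  set K := a ^ (p / q) * b ^ (1 - p / q) with hK
  have hK0 : 0 < K := by positivity
  refine lpow_le hx hp.le fun r e hr he hre => ?_
  have key : r ^ p ≤ K * (p / q) / a * r ^ q + K * (1 - p / q) / b := by
    -- Weighted AM-GM for `r ^ q / a` and `1 / b`; multiplying by `K` clears the denominators on the
    -- left.
    have h := Real.geom_mean_le_arith_mean2_weighted hw1 hw2
      (show 0 ≤ r ^ q / a by positivity) (show 0 ≤ 1 / b by positivity) (by ring)
    rw [Real.div_rpow (by positivity) ha.le, Real.div_rpow zero_le_one hb.le, Real.one_rpow,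
      ← Real.rpow_mul hr, mul_div_cancel₀ _ hq.ne'] at h
    have h' := mul_le_mul_of_nonneg_left h hK0.le
    have e1 : K * (r ^ p / a ^ (p / q) * (1 / b ^ (1 - p / q))) = r ^ p := by
      have : a ^ (p / q) ≠ 0 := by positivity
      have : b ^ (1 - p / q) ≠ 0 := by positivity
      rw [hK]; field_simp
    rw [e1] at h'
    calc r ^ p ≤ _ := h'
      _ = _ := by ring
  calc r ^ p • e ≤ (K * (p / q) / a * r ^ q + K * (1 - p / q) / b) • e :=
        smul_le_smul_of_nonneg_right key (idem_nonneg he)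
    _ = (K * (p / q) / a) • (r ^ q • e) + (K * (1 - p / q) / b) • e := by
        rw [add_smul, smul_smul]
    _ ≤ _ := by
        refine add_le_add (smul_le_smul_of_nonneg_left
          (smul_idem_le_lpow hx hq.le hr he hre) (by positivity))
          (smul_le_smul_of_nonneg_left (idem_le_one he) (by positivity))

/-- For real `t ≥ 0`, `min (t ^ p) (c ^ p) ≤ c ^ (p - 1) * t`, by comparing `t` with `c`.
Distributivity of the meet over suprema reduces the claim to the generators `r ^ p • e`. -/
theorem lpow_inf_le {c : ℝ} (hx : 0 ≤ x) (hp : 1 ≤ p) (hc : 0 < c) :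
    lpow x p ⊓ c ^ p • (1 : 𝕃) ≤ c ^ (p - 1) • lpow x 1 := by
  have hp0 : 0 < p := one_pos.trans_le hp
  refine inf_le_of_isLUB (isLUB_lpow hx hp0.le) ?_
  rintro _ ⟨r, e, hr, he, hre, rfl⟩
  have h1 : c ^ (p - 1) • (r • e) ≤ c ^ (p - 1) • lpow x 1 := by
    refine smul_le_smul_of_nonneg_left ?_ (by positivity)
    simpa using smul_idem_le_lpow hx zero_le_one hr he hre
  refine le_trans ?_ h1
  rw [smul_smul]
  rcases le_total r c with h | h
  · refine inf_le_left.trans (smul_le_smul_of_nonneg_right ?_ (idem_nonneg he))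
    have h2 : r ^ p = r ^ (p - 1) * r := by
      rcases hr.eq_or_lt with rfl | hr'
      · simp [Real.zero_rpow hp0.ne']
      · rw [← Real.rpow_add_one hr'.ne']; simp
    rw [h2]
    exact mul_le_mul_of_nonneg_right (Real.rpow_le_rpow hr h (by linarith)) hr
  · have h2 : c ^ p ≤ c ^ (p - 1) * r := by
      have : c ^ p = c ^ (p - 1) * c := by rw [← Real.rpow_add_one hc.ne']; simp
      rw [this]
      exact mul_le_mul_of_nonneg_left h (by positivity)
    refine le_trans ?_ (smul_le_smul_of_nonneg_right h2 (idem_nonneg he))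
    set w := r ^ p • e ⊓ c ^ p • (1 : 𝕃) with hw
    have hz : (1 - e) * w ≤ 0 := by
      calc (1 - e) * w ≤ (1 - e) * (r ^ p • e) :=
            mul_le_mul_of_nonneg_left inf_le_left (idem_nonneg (idem_compl he))
        _ = 0 := by rw [mul_smul_comm, sub_mul, he]; simp
    have hz' : e * w ≤ c ^ p • e := by
      simpa using mul_le_mul_of_nonneg_left (inf_le_right : w ≤ c ^ p • (1 : 𝕃)) (idem_nonneg he)
    calc w = e * w + (1 - e) * w := by rw [← add_mul]; simp
      _ ≤ c ^ p • e + 0 := add_le_add hz' hz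
      _ = _ := add_zero _

end LPow

end Algebra

/-! ### Finite additivity and integrals of step functions -/

section Measure

variable {S 𝕃 : Type*} [MeasurableSpace S] [ConditionallyCompleteLattice 𝕃] [Ring 𝕃] [Algebra ℝ 𝕃]
  [IsFAlgebra 𝕃] (μ : LMeasure S 𝕃)

namespace LMeasure

theorem toFun_union {A B : Set S} (hA : MeasurableSet A) (hB : MeasurableSet B)
    (hAB : Disjoint A B) : μ.toFun (A ∪ B) = μ.toFun A + μ.toFun B := by
  let C : ℕ → Set S := fun n => if n = 0 then A else if n = 1 then B else ∅
  have hC0 : C 0 = A := rfl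
  have hC1 : C 1 = B := rfl
  have hC2 : ∀ n, n ∉ Finset.range 2 → C n = ∅ := by
    intro n hn
    have : 1 < n := by simpa using hn
    simp [C, show n ≠ 0 by omega, show n ≠ 1 by omega]
  have hmeas : ∀ n, MeasurableSet (C n) := by
    intro n
    by_cases h0 : n = 0
    · simpa [C, h0] using hA
    · by_cases h1 : n = 1
      · simpa [C, h1] using hB
      · simp [C, h0, h1]
  have hdisj : Pairwise (Function.onFun Disjoint C) := by
    intro m n hmn
    simp only [Function.onFun, C]
    split_ifs <;> first | omega | exact hAB | exact hAB.symm | simp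
  have hU : ⋃ n, C n = A ∪ B := by
    refine Set.Subset.antisymm (Set.iUnion_subset fun n => ?_)
      (Set.union_subset (Set.subset_iUnion C 0) (Set.subset_iUnion C 1))
    simp only [C]
    split_ifs <;> simp
  have h := μ.iUnion' C hmeas hdisj
  rw [hU] at h
  -- For the sequence `A, B, ∅, ∅, …` the supremum of finite sums is attained at the index set `{0,
  -- 1}`.
  refine h.unique (IsGreatest.isLUB ⟨⟨Finset.range 2, by simp [Finset.sum_range_succ, hC0, hC1]⟩, ?_⟩)
  rintro _ ⟨F, rfl⟩
  have h1 : ∑ n ∈ F, μ.toFun (C n) = ∑ n ∈ F with n ∈ Finset.range 2, μ.toFun (C n) := by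
    refine (Finset.sum_filter_of_ne fun n _ hn => ?_).symm
    by_contra hc
    exact hn (by rw [hC2 n hc, μ.empty'])
  calc ∑ n ∈ F, μ.toFun (C n) ≤ ∑ n ∈ Finset.range 2, μ.toFun (C n) := by
        rw [h1]
        refine Finset.sum_le_sum_of_subset_of_nonneg (fun n hn => (Finset.mem_filter.1 hn).2)
          fun n _ _ => μ.nonneg' _ (hmeas n)
    _ = _ := by simp [Finset.sum_range_succ, hC0, hC1]

theorem toFun_mono {A B : Set S} (hA : MeasurableSet A) (hB : MeasurableSet B) (h : A ⊆ B) :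
    μ.toFun A ≤ μ.toFun B := by
  rw [← Set.union_sdiff_cancel h, μ.toFun_union hA (hB.diff hA) Set.disjoint_sdiff_right]
  exact le_add_of_nonneg_right (μ.nonneg' _ (hB.diff hA))

theorem toFun_preimage_finset {β : Type*} (φ : SimpleFunc S β) (s : Finset β) :
    μ.toFun (φ ⁻¹' (s : Set β)) = ∑ x ∈ s, μ.toFun (φ ⁻¹' {x}) := by
  classical
  induction s using Finset.induction_on with
  | empty => simpa using μ.empty'
  | insert a s ha ih =>
    rw [Finset.sum_insert ha, ← ih, Finset.coe_insert, Set.insert_eq, Set.preimage_union]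
    refine μ.toFun_union (φ.measurableSet_preimage _) (φ.measurableSet_preimage _) ?_
    exact Disjoint.preimage _ (by simpa using ha)

theorem toFun_univ_eq_sum {β : Type*} (φ : SimpleFunc S β) :
    μ.toFun Set.univ = ∑ x ∈ φ.range, μ.toFun (φ ⁻¹' {x}) := by
  rw [← μ.toFun_preimage_finset, SimpleFunc.coe_range, Set.preimage_range]

open Classical in
-- Grouping the fibres of `φ` by their value under `g` shows that the integral may be computed on
-- any finer partition.
theorem stepIntegral_map {β : Type*} (φ : SimpleFunc S β) (g : β → 𝕃) :
    μ.stepIntegral (φ.map g) = ∑ x ∈ φ.range, g x * μ.toFun (φ ⁻¹' {x}) := by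
  simp only [stepIntegral, SimpleFunc.range_map]
  refine Finset.sum_image' _ fun b _ => ?_
  rw [SimpleFunc.map_preimage_singleton, μ.toFun_preimage_finset, Finset.mul_sum]
  refine Finset.sum_congr ?_ fun x hx => ?_
  · ext; simp
  · rw [(Finset.mem_filter.1 hx).2]

theorem stepIntegral_le_of_le {ψ φ χ : SimpleFunc S 𝕃} {A B : ℝ}
    (h : ∀ s, ψ s ≤ A • φ s + B • (1 : 𝕃) + χ s) :
    μ.stepIntegral ψ ≤ A • μ.stepIntegral φ + B • μ.toFun Set.univ + μ.stepIntegral χ := by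
  -- The fibres of the triple form a common partition for the three step functions.
  set P := ψ.pair (φ.pair χ) with hP
  have h1 : ψ = P.map fun z => z.1 := by ext s; simp [hP]
  have h2 : φ = P.map fun z => z.2.1 := by ext s; simp [hP]
  have h3 : χ = P.map fun z => z.2.2 := by ext s; simp [hP]
  have e1 : μ.stepIntegral ψ = ∑ z ∈ P.range, z.1 * μ.toFun (P ⁻¹' {z}) := by
    rw [← stepIntegral_map, ← h1]
  have e2 : μ.stepIntegral φ = ∑ z ∈ P.range, z.2.1 * μ.toFun (P ⁻¹' {z}) := by
    rw [← stepIntegral_map μ P fun z => z.2.1, ← h2]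
  have e3 : μ.stepIntegral χ = ∑ z ∈ P.range, z.2.2 * μ.toFun (P ⁻¹' {z}) := by
    rw [← stepIntegral_map μ P fun z => z.2.2, ← h3]
  rw [e1, e2, e3, μ.toFun_univ_eq_sum P,
    Finset.smul_sum, Finset.smul_sum, ← Finset.sum_add_distrib, ← Finset.sum_add_distrib]
  refine Finset.sum_le_sum fun z hz => ?_
  obtain ⟨s, rfl⟩ := SimpleFunc.mem_range.1 hz
  have := mul_le_mul_of_nonneg_right (h s) (μ.nonneg' _ (P.measurableSet_preimage {P s}))
  simpa [add_mul, hP] using this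

theorem stepIntegral_nonneg {φ : SimpleFunc S 𝕃} (h : ∀ s, 0 ≤ φ s) : 0 ≤ μ.stepIntegral φ := by
  refine Finset.sum_nonneg fun x hx => ?_
  obtain ⟨s, rfl⟩ := SimpleFunc.mem_range.1 hx
  exact mul_nonneg (h s) (μ.nonneg' _ (φ.measurableSet_preimage _))

/-- A fibre inside the null set contributes nothing; any other contains a point where `φ ≤ c`, and
`φ` is constant on it. -/
theorem stepIntegral_le_of_ae_le {φ : SimpleFunc S 𝕃} {c : 𝕃} (h : μ.AE fun s => φ s ≤ c) :
    μ.stepIntegral φ ≤ c * μ.toFun Set.univ := by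
  obtain ⟨N, hN, hN0, hsub⟩ := h
  rw [μ.toFun_univ_eq_sum φ, Finset.mul_sum]
  refine Finset.sum_le_sum fun x _ => ?_
  have hm := φ.measurableSet_preimage {x}
  by_cases hx : φ ⁻¹' {x} ⊆ N
  · have : μ.toFun (φ ⁻¹' {x}) = 0 :=
      le_antisymm (hN0 ▸ μ.toFun_mono hm hN hx) (μ.nonneg' _ hm)
    simp [this]
  · obtain ⟨s, hs, hsN⟩ := Set.not_subset.1 hx
    have : φ s ≤ c := by
      by_contra hc
      exact hsN (hsub hc)
    rw [show φ s = x from hs] at this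
    exact mul_le_mul_of_nonneg_right this (μ.nonneg' _ hm)

/-! ### Properness: comparison and uniqueness of integrals -/

variable {μ}

/-- With `φ n` increasing to `g`, the excess of `ψ` over `A • φ n + B • 1` consists of bounded step
functions decreasing to `0`, because `ψ` is bounded. By properness their integrals decrease to `0`.
-/
theorem IsProper.stepIntegral_le (hμ : μ.IsProper) {g : S → 𝕃} {J : 𝕃} (hg : μ.HasIntegral g J)
    {ψ : SimpleFunc S 𝕃} (hψ : IsBoundedPosStep ψ) {A B : ℝ} (hA : 0 ≤ A) (hB : 0 ≤ B)
    (h : ∀ s, ψ s ≤ A • g s + B • (1 : 𝕃)) :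
    μ.stepIntegral ψ ≤ A • J + B • μ.toFun Set.univ := by
  obtain ⟨φ, hφ, hinc, hJ⟩ := hg
  let χ : ℕ → SimpleFunc S 𝕃 := fun n =>
    (ψ.pair (φ n)).map fun z => (z.1 - A • z.2 - B • (1 : 𝕃)) ⊔ 0
  have hχ : ∀ n s, χ n s = (ψ s - A • φ n s - B • (1 : 𝕃)) ⊔ 0 := fun n s => rfl
  have hB1 : 0 ≤ B • (1 : 𝕃) := smul_nonneg hB zero_le_one
  have hbdd : ∀ n, IsBoundedPosStep (χ n) := by
    intro n s
    obtain ⟨h0, c, hc⟩ := hψ s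
    have hpos : 0 ≤ χ n s := by rw [hχ]; exact le_sup_right
    refine ⟨hpos, c, ?_⟩
    rw [abs_of_nonneg h0] at hc
    rw [abs_of_nonneg hpos, hχ]
    refine sup_le ((sub_le_self _ hB1).trans ((sub_le_self _ ?_).trans hc)) (h0.trans hc)
    exact smul_nonneg hA (hφ n s).1
  have hdec : ∀ s, DecreasesTo (fun n => χ n s) 0 := by
    intro s
    refine ⟨fun m n hmn => ?_, ?_, fun b hb => ?_⟩
    · simp only [hχ]
      refine sup_le_sup_right (sub_le_sub_right (sub_le_sub_left ?_ _) _) _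
      exact smul_le_smul_of_nonneg_left ((hinc s).1 hmn) hA
    · rintro _ ⟨n, rfl⟩; exact (hbdd n s).1
    -- The excess is at most `A • (g - φ n)`, whose infimum is `0`.
    · have hb' : ∀ n, b ≤ A • (g s - φ n s) := by
        intro n
        refine (hb ⟨n, rfl⟩).trans ?_
        simp only [hχ]
        refine sup_le ?_ (smul_nonneg hA (sub_nonneg.2 ((hinc s).2.1 ⟨n, rfl⟩)))
        rw [smul_sub, sub_right_comm]
        exact sub_le_sub_right (sub_le_iff_le_add.2 (h s)) _
      rcases hA.eq_or_lt with rfl | hA'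
      · simpa using hb' 0
      · have : g s ≤ g s - A⁻¹ • b := by
          refine (hinc s).2.2 ?_
          rintro _ ⟨n, rfl⟩
          have := smul_le_smul_of_nonneg_left (hb' n) (inv_pos.2 hA').le
          rw [smul_smul, inv_mul_cancel₀ hA'.ne', one_smul] at this
          exact le_sub_comm.1 this
        have h0 : A⁻¹ • b ≤ 0 := by simpa using this
        have := smul_le_smul_of_nonneg_left h0 hA
        rwa [smul_smul, mul_inv_cancel₀ hA'.ne', one_smul, smul_zero] at this
  have hlim := (hμ χ hbdd hdec).2
  rw [← sub_nonpos]
  refine hlim.2 ?_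
  rintro _ ⟨n, rfl⟩
  have h1 : μ.stepIntegral ψ ≤
      A • μ.stepIntegral (φ n) + B • μ.toFun Set.univ + μ.stepIntegral (χ n) := by
    refine μ.stepIntegral_le_of_le fun s => ?_
    have : ψ s - A • φ n s - B • (1 : 𝕃) ≤ χ n s := by rw [hχ]; exact le_sup_left
    rwa [sub_sub, sub_le_iff_le_add'] at this
  rw [sub_le_iff_le_add']
  refine h1.trans (add_le_add_left (add_le_add_left ?_ _) _)
  exact smul_le_smul_of_nonneg_left (hJ.1 ⟨n, rfl⟩) hA

theorem IsProper.hasIntegral_le (hμ : μ.IsProper) {f g : S → 𝕃} {I J : 𝕃}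
    (hf : μ.HasIntegral f I) (hg : μ.HasIntegral g J) {A B : ℝ} (hA : 0 ≤ A) (hB : 0 ≤ B)
    (h : ∀ s, f s ≤ A • g s + B • (1 : 𝕃)) : I ≤ A • J + B • μ.toFun Set.univ := by
  obtain ⟨φ, hφ, hinc, hI⟩ := hf
  refine hI.2 ?_
  rintro _ ⟨n, rfl⟩
  exact hμ.stepIntegral_le hg (hφ n) hA hB fun s => ((hinc s).2.1 ⟨n, rfl⟩).trans (h s)

/-- Comparing `f` with itself (`A = 1`, `B = 0`) shows that the integral does not depend on the
approximating sequence. -/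
theorem IsProper.integral_eq (hμ : μ.IsProper) {f : S → 𝕃} {I : 𝕃} (hf : μ.HasIntegral f I) :
    μ.integral f = I := by
  have hex : ∃ I, μ.HasIntegral f I := ⟨I, hf⟩
  rw [integral, dif_pos hex]
  have key : ∀ I J, μ.HasIntegral f I → μ.HasIntegral f J → I ≤ J := fun I J hI hJ => by
    simpa using hμ.hasIntegral_le (A := 1) (B := 0) hI hJ zero_le_one le_rfl (fun s => by simp)
  exact le_antisymm (key _ _ hex.choose_spec hf) (key _ _ hf hex.choose_spec)

theorem HasIntegral.nonneg {f : S → 𝕃} {I : 𝕃} (hf : μ.HasIntegral f I) : 0 ≤ I := by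
  obtain ⟨φ, hφ, -, hI⟩ := hf
  exact (μ.stepIntegral_nonneg fun s => (hφ 0 s).1).trans (hI.1 ⟨0, rfl⟩)

end LMeasure

/-! ### Measurable functions -/

theorem IncreasesTo.add {u v : ℕ → 𝕃} {x y : 𝕃} (hu : IncreasesTo u x) (hv : IncreasesTo v y) :
    IncreasesTo (fun n => u n + v n) (x + y) := by
  refine ⟨hu.1.add hv.1, ?_, fun b hb => ?_⟩
  · rintro _ ⟨n, rfl⟩; exact add_le_add (hu.2.1 ⟨n, rfl⟩) (hv.2.1 ⟨n, rfl⟩)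
  · rw [← le_sub_iff_add_le]
    refine hu.2.2 ?_
    rintro _ ⟨m, rfl⟩
    rw [le_sub_comm]
    refine hv.2.2 ?_
    rintro _ ⟨n, rfl⟩
    rw [le_sub_iff_add_le']
    exact (add_le_add (hu.1 (le_max_left m n)) (hv.1 (le_max_right m n))).trans
      (hb ⟨max m n, rfl⟩)

theorem IsLMeasurable.abs {f : S → 𝕃} (hf : IsLMeasurable f) :
    IsMeasurablePos fun s => |f s| := by
  obtain ⟨⟨φ, hφ, hφi⟩, ψ, hψ, hψi⟩ := hf
  refine ⟨fun n => φ n + ψ n, fun n s => add_nonneg (hφ n s) (hψ n s), fun s => ?_⟩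
  have h := (hφi s).add (hψi s)
  dsimp only at h
  rw [← posPart_def, ← negPart_def, posPart_add_negPart] at h
  exact h

theorem IsMeasurablePos.lpow {f : S → 𝕃} (hf : IsMeasurablePos f) {p : ℝ} (hp : 0 < p) :
    IsMeasurablePos fun s => lpow (f s) p := by
  obtain ⟨φ, hφ, hφi⟩ := hf
  exact ⟨fun n => (φ n).map fun x => LValued.lpow x p, fun n s => lpow_nonneg (hφ n s) hp.le,
    fun s => increasesTo_lpow (fun n => hφ n s) (hφi s) hp⟩

theorem IsMeasurablePos.isLMeasurable {f : S → 𝕃} (hf : IsMeasurablePos f) : IsLMeasurable f := by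
  have h0 : ∀ s, 0 ≤ f s := by
    obtain ⟨φ, hφ, hφi⟩ := hf
    exact fun s => (hφ 0 s).trans ((hφi s).2.1 ⟨0, rfl⟩)
  refine ⟨?_, fun _ => 0, fun _ _ => le_rfl, fun s => ?_⟩
  · simpa only [sup_of_le_left (h0 _)] using hf
  · dsimp only
    rw [sup_of_le_right (neg_nonpos.2 (h0 s))]
    refine ⟨monotone_const, ?_⟩
    simp

theorem IsMeasurablePos.exists_bounded {f : S → 𝕃} (hf : IsMeasurablePos f) :
    ∃ ψ : ℕ → SimpleFunc S 𝕃, (∀ n, IsBoundedPosStep (ψ n)) ∧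
      (∀ s, IncreasesTo (fun n => ψ n s) (f s)) ∧ ∀ n s, ψ n s ≤ (n : ℝ) • (1 : 𝕃) := by
  obtain ⟨φ, hφ, hφi⟩ := hf
  refine ⟨fun n => (φ n).map fun x => x ⊓ (n : ℝ) • (1 : 𝕃), fun n s => ?_,
    fun s => increasesTo_inf_natCast (fun n => hφ n s) (hφi s), fun n s => inf_le_right⟩
  have h0 : 0 ≤ φ n s ⊓ (n : ℝ) • (1 : 𝕃) :=
    le_inf (hφ n s) (smul_nonneg (Nat.cast_nonneg n) zero_le_one)
  refine ⟨h0, n, ?_⟩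
  change |φ n s ⊓ (n : ℝ) • (1 : 𝕃)| ≤ _
  rw [abs_of_nonneg h0]
  exact inf_le_right

/-! ### Norm inequality, inclusions and null spaces -/

namespace LMeasure

variable {μ}

/-- By Dedekind completeness, integrability only requires an upper bound for the step integrals. -/
theorem exists_hasIntegral {f : S → 𝕃} {ψ : ℕ → SimpleFunc S 𝕃} {b : 𝕃}
    (hψ : ∀ n, IsBoundedPosStep (ψ n)) (hi : ∀ s, IncreasesTo (fun n => ψ n s) (f s))
    (hb : ∀ n, μ.stepIntegral (ψ n) ≤ b) : ∃ I, μ.HasIntegral f I ∧ I ≤ b := by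
  have hb' : b ∈ upperBounds (Set.range fun n => μ.stepIntegral (ψ n)) := by
    rintro _ ⟨n, rfl⟩; exact hb n
  have h := isLUB_csSup (Set.range_nonempty fun n => μ.stepIntegral (ψ n)) ⟨b, hb'⟩
  exact ⟨_, ⟨ψ, hψ, hi, h⟩, h.2 hb'⟩

theorem mem_Lp_iff {p : ℝ≥0∞} (hp : 1 ≤ p) (hp' : p ≠ ∞) {f : S → 𝕃} :
    f ∈ μ.Lp p ↔ IsLMeasurable f ∧ ∃ I, μ.HasIntegral (fun s => lpow |f s| p.toReal) I := by
  have hp0 : 0 < p.toReal := ENNReal.toReal_pos (one_pos.trans_le hp).ne' hp'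
  rw [Lp, if_neg hp', Set.mem_ofPred_eq, Integrable]
  have habs : ∀ s, |lpow |f s| p.toReal| = lpow |f s| p.toReal := fun s =>
    abs_of_nonneg (lpow_nonneg (abs_nonneg (f s)) hp0.le)
  simp only [habs]
  exact ⟨fun h => ⟨h.1, h.2.2⟩, fun h => ⟨h.1, (h.1.abs.lpow hp0).isLMeasurable, h.2⟩⟩

theorem IsProper.norm_eq (hμ : μ.IsProper) {p : ℝ≥0∞} (hp' : p ≠ ∞) {f : S → 𝕃} {I : 𝕃}
    (hI : μ.HasIntegral (fun s => lpow |f s| p.toReal) I) :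
    μ.norm p f = lpow I (1 / p.toReal) := by
  rw [norm, if_neg hp', hμ.integral_eq hI]

theorem IsProper.norm_nonneg (hμ : μ.IsProper) {p : ℝ≥0∞} (hp : 1 ≤ p) (hp' : p ≠ ∞) {f : S → 𝕃}
    (hf : f ∈ μ.Lp p) : 0 ≤ μ.norm p f := by
  obtain ⟨-, I, hI⟩ := (mem_Lp_iff hp hp').1 hf
  rw [hμ.norm_eq hp' hI]
  exact lpow_nonneg hI.nonneg (by positivity)

/-- Hölder's inequality against the constant function one. -/
theorem IsProper.lpow_integral_le (hμ : μ.IsProper) {p q : ℝ} (hp : 0 < p) (hpq : p ≤ q)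
    {g : S → 𝕃} (hg : ∀ s, 0 ≤ g s) {I J : 𝕃} (hI : μ.HasIntegral (fun s => lpow (g s) p) I)
    (hJ : μ.HasIntegral (fun s => lpow (g s) q) J) :
    lpow I (1 / p) ≤ lpow J (1 / q) * lpow (μ.toFun Set.univ) (1 / p - 1 / q) := by
  have hq : 0 < q := hp.trans_le hpq
  have hM : 0 ≤ μ.toFun Set.univ := μ.nonneg' _ MeasurableSet.univ
  have hs : 0 ≤ 1 / p - 1 / q := sub_nonneg.2 (one_div_le_one_div_of_le hp hpq)
  have hq' : 0 ≤ 1 / q := by positivity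
  have hw : 0 ≤ 1 - p / q := by rw [sub_nonneg, div_le_one hq]; exact hpq
  refine lpow_le_mul hJ.nonneg hM hI.nonneg (lpow_nonneg hJ.nonneg hq') (lpow_nonneg hM hs) hq' hs
    hp (fun a e ha he h => smul_idem_le_lpow hJ.nonneg hq' ha he h)
    (fun b e hb he h => smul_idem_le_lpow hM hs hb he h) fun a b e ha hb he hxa hyb => ?_
  have hK : (a ^ (1 / q) * b ^ (1 / p - 1 / q)) ^ p = a ^ (p / q) * b ^ (1 - p / q) := by
    rw [Real.mul_rpow (by positivity) (by positivity), ← Real.rpow_mul ha.le, ← Real.rpow_mul hb.le]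
    congr 2 <;> field_simp
  set K := a ^ (p / q) * b ^ (1 - p / q) with hKdef
  have hK0 : 0 ≤ K := by positivity
  -- Young's inequality integrated. On `e` the bounds `J ≤ a` and `μ(S) ≤ b` cancel the
  -- denominators, and the two weights add up to `1`, leaving `K`.
  have h1 := hμ.hasIntegral_le hI hJ (A := K * (p / q) / a) (B := K * (1 - p / q) / b)
    (by positivity) (by positivity) fun s => lpow_le_smul_lpow_add (hg s) hp hpq ha hb
  have h2 := mul_le_mul_of_nonneg_left h1 (idem_nonneg he)
  rw [hK]
  refine h2.trans ?_
  rw [mul_add, mul_smul_comm, mul_smul_comm]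
  refine (add_le_add (smul_le_smul_of_nonneg_left hxa (by positivity))
    (smul_le_smul_of_nonneg_left hyb (by positivity))).trans_eq ?_
  rw [smul_smul, smul_smul, ← add_smul]
  congr 1
  field_simp
  ring

theorem IsProper.Lp_subset_and_norm_le (hμ : μ.IsProper) {p q : ℝ≥0∞} (hp : 1 ≤ p) (hpq : p < q)
    {f : S → 𝕃} (hf : f ∈ μ.Lp q) :
    f ∈ μ.Lp p ∧
      μ.norm p f ≤ μ.norm q f * lpow (μ.toFun Set.univ) (p⁻¹ - q⁻¹).toReal := by
  have hp' : p ≠ ∞ := hpq.ne_top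
  have hp0 : 0 < p.toReal := ENNReal.toReal_pos (one_pos.trans_le hp).ne' hp'
  have hM : 0 ≤ μ.toFun Set.univ := μ.nonneg' _ MeasurableSet.univ
  by_cases hq' : q = ∞
  · subst hq'
    have hf' : μ.EssBounded f := by simpa [Lp] using hf
    obtain ⟨hfm, l₀, hl₀, hae₀⟩ := hf'
    obtain ⟨ψ, hψ, hψi, -⟩ := (hfm.abs.lpow hp0).exists_bounded
    have hstep : ∀ l : 𝕃, 0 ≤ l → μ.AE (fun s => |f s| ≤ l) → ∀ n,
        μ.stepIntegral (ψ n) ≤ lpow l p.toReal * μ.toFun Set.univ := by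
      rintro l hl ⟨N, hN, hN0, hsub⟩ n
      refine μ.stepIntegral_le_of_ae_le ⟨N, hN, hN0, fun s hs => hsub fun hle => hs ?_⟩
      exact ((hψi s).2.1 ⟨n, rfl⟩).trans (lpow_mono (abs_nonneg _) hle hp0.le)
    obtain ⟨I, hI, -⟩ := exists_hasIntegral hψ hψi (hstep l₀ hl₀ hae₀)
    refine ⟨(mem_Lp_iff hp hp').2 ⟨hfm, I, hI⟩, ?_⟩
    rw [hμ.norm_eq hp' hI, norm, if_pos rfl, ENNReal.inv_top, tsub_zero, ENNReal.toReal_inv]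
    have hinv : 0 ≤ p.toReal⁻¹ := by positivity
    refine le_csInf_mul ⟨l₀, hl₀, hae₀⟩ ⟨0, fun l hl => hl.1⟩ ?_
    rintro l ⟨hl, hae⟩
    -- The same sequence `ψ` serves every essential bound `l`, and uniqueness of the integral
    -- identifies `J` with `I`.
    have hIl : I ≤ lpow l p.toReal * μ.toFun Set.univ := by
      obtain ⟨J, hJ, hJle⟩ := exists_hasIntegral hψ hψi (hstep l hl hae)
      rwa [← hμ.integral_eq hI, hμ.integral_eq hJ]
    -- With exponent `u = 1` the first factor can be `l` itself, so `(l ^ p) ^ (1/p)` need not be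
    -- simplified.
    refine lpow_le_mul (u := 1) (s := p.toReal⁻¹) hl hM hI.nonneg hl (lpow_nonneg hM hinv)
      zero_le_one hinv hp0 (fun a e _ _ h => by simpa using h)
      (fun b e hb he h => smul_idem_le_lpow hM hinv hb he h) fun a b e ha hb he hxa hyb => ?_
    rw [Real.mul_rpow (by positivity) (by positivity), Real.rpow_one, ← Real.rpow_mul hb.le,
      inv_mul_cancel₀ hp0.ne', Real.rpow_one]
    calc e * I ≤ e * (lpow l p.toReal * μ.toFun Set.univ) :=
          mul_le_mul_of_nonneg_left hIl (idem_nonneg he)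
      _ = (e * lpow l p.toReal) * (e * μ.toFun Set.univ) := by
          rw [idem_mul_comm he (lpow l p.toReal), mul_assoc _ e, idem_mul_idem_mul he,
            ← mul_assoc, idem_mul_comm he (lpow l p.toReal), mul_assoc]
      _ ≤ (a ^ p.toReal • e) * (b • e) :=
          mul_le_mul (idem_mul_lpow_le hl hp0.le he ha.le hxa) hyb
            (mul_nonneg (idem_nonneg he) hM) (smul_nonneg (by positivity) (idem_nonneg he))
      _ = _ := by rw [smul_mul_smul_comm, he]
  · have hq := hp.trans hpq.le
    obtain ⟨hfm, J, hJ⟩ := (mem_Lp_iff hq hq').1 hf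
    have hpq' : p.toReal ≤ q.toReal := ENNReal.toReal_mono hq' hpq.le
    have hw : 0 ≤ 1 - p.toReal / q.toReal := by
      rw [sub_nonneg, div_le_one (hp0.trans_le hpq')]; exact hpq'
    obtain ⟨ψ, hψ, hψi, -⟩ := (hfm.abs.lpow hp0).exists_bounded
    -- Existence needs only some upper bound, so Young's inequality with `a = b = 1` suffices.
    obtain ⟨I, hI, -⟩ := exists_hasIntegral hψ hψi fun n =>
      hμ.stepIntegral_le hJ (hψ n) (by positivity) (by positivity) fun s =>
        ((hψi s).2.1 ⟨n, rfl⟩).trans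
          (lpow_le_smul_lpow_add (abs_nonneg (f s)) hp0 hpq' one_pos one_pos)
    refine ⟨(mem_Lp_iff hp hp').2 ⟨hfm, I, hI⟩, ?_⟩
    have hp1 : p⁻¹ ≠ ∞ := ENNReal.inv_ne_top.2 (one_pos.trans_le hp).ne'
    rw [hμ.norm_eq hp' hI, hμ.norm_eq hq' hJ,
      ENNReal.toReal_sub_of_le (ENNReal.inv_le_inv.2 hpq.le) hp1, ENNReal.toReal_inv,
      ENNReal.toReal_inv, ← one_div p.toReal, ← one_div q.toReal]
    exact hμ.lpow_integral_le hp0 hpq' (fun s => abs_nonneg (f s)) hI hJ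

theorem IsProper.nullSpace_subset_of_lt (hμ : μ.IsProper) {p q : ℝ≥0∞} (hp : 1 ≤ p)
    (hpq : p < q) : μ.nullSpace q ⊆ μ.nullSpace p := by
  rintro f ⟨hf, h0⟩
  obtain ⟨hf', hle⟩ := hμ.Lp_subset_and_norm_le hp hpq hf
  rw [h0, zero_mul] at hle
  exact ⟨hf', le_antisymm hle (hμ.norm_nonneg hp hpq.ne_top hf')⟩

theorem IsProper.nullSpace_one_subset (hμ : μ.IsProper) {p : ℝ≥0∞} (hp : 1 ≤ p) (hp' : p ≠ ∞) :
    μ.nullSpace 1 ⊆ μ.nullSpace p := by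
  have hp0 : 0 < p.toReal := ENNReal.toReal_pos (one_pos.trans_le hp).ne' hp'
  have hp1 : 1 ≤ p.toReal := by simpa using ENNReal.toReal_mono hp' hp
  rintro f ⟨hf, h0⟩
  obtain ⟨hfm, I, hI⟩ := (mem_Lp_iff le_rfl ENNReal.one_ne_top).1 hf
  rw [hμ.norm_eq ENNReal.one_ne_top hI] at h0
  have hI0 : I = 0 := eq_zero_of_lpow_eq_zero hI.nonneg (by simp) h0
  subst hI0
  obtain ⟨ψ, hψ, hψi, hψn⟩ := (hfm.abs.lpow hp0).exists_bounded
  have hψ0 : ∀ n, μ.stepIntegral (ψ n) ≤ 0 := by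
    intro n
    have hn : (0 : ℝ) < n + 1 := by positivity
    -- Here `ψ n` lies below both `|f| ^ p` and `n ≤ (n + 1) ^ p`, so `lpow_inf_le` with `c = n + 1`
    -- applies; `n + 1` keeps `c` positive at `n = 0`. The resulting multiple of the integral of
    -- `|f|` is `0`.
    have h := hμ.stepIntegral_le hI (hψ n) (A := (n + 1 : ℝ) ^ (p.toReal - 1)) (B := 0)
      (by positivity) le_rfl fun s => by
        rw [zero_smul, add_zero, ENNReal.toReal_one]
        refine le_trans (le_inf ((hψi s).2.1 ⟨n, rfl⟩) ((hψn n s).trans ?_))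
          (lpow_inf_le (abs_nonneg (f s)) hp1 hn)
        refine smul_le_smul_of_nonneg_right ?_ zero_le_one
        have := Real.rpow_le_rpow_of_exponent_le (x := n + 1) (by simp) hp1
        rw [Real.rpow_one] at this
        linarith
    simpa using h
  obtain ⟨J, hJ, hJ0⟩ := exists_hasIntegral hψ hψi hψ0
  have hJ' : J = 0 := le_antisymm hJ0 hJ.nonneg
  subst hJ'
  refine ⟨(mem_Lp_iff hp hp').2 ⟨hfm, 0, hJ⟩, ?_⟩
  rw [hμ.norm_eq hp' hJ, lpow_zero_of_pos (by positivity)]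

end LMeasure

end Measure

end LValued

theorem mainTheorem9 {S 𝕃 : Type*} [MeasurableSpace S]
    [ConditionallyCompleteLattice 𝕃] [Ring 𝕃] [Algebra ℝ 𝕃] [IsFAlgebra 𝕃]
    (μ : LValued.LMeasure S 𝕃) (hμ : μ.IsProper)
    (p q : ℝ≥0∞) (hp : 1 ≤ p) (hpq : p < q) :
    μ.Lp q ⊆ μ.Lp p ∧
    (∀ f ∈ μ.Lp q,
      μ.norm p f ≤ μ.norm q f * LValued.lpow (μ.toFun Set.univ) (p⁻¹ - q⁻¹).toReal) ∧
    μ.nullSpace ∞ ⊆ μ.nullSpace 1 ∧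
    μ.nullSpace 1 = μ.nullSpace p := by
  refine ⟨fun f hf => (hμ.Lp_subset_and_norm_le hp hpq hf).1,
    fun f hf => (hμ.Lp_subset_and_norm_le hp hpq hf).2,
    hμ.nullSpace_subset_of_lt le_rfl ENNReal.one_lt_top,
    Set.Subset.antisymm (hμ.nullSpace_one_subset hp hpq.ne_top) ?_⟩
  rcases hp.eq_or_lt with rfl | h
  · exact subset_rfl
  · exact hμ.nullSpace_subset_of_lt le_rfl h
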